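/- Let $M$ be a smooth Hausdorff $4$-manifold with a smooth metric $g$ of signature $(-,+,+,+)$, and let $\pi\colon OM\to M$ be the bundle of pseudo-orthonormal frames. Let $\theta$ be the canonical $\mathbb{R}^4$-valued $1$-form of $OM$ and $\omega$ the Levi-Civita connection form, with values in the Lie algebra $\mathfrak{l}$ of the Lorentz group, and give $OM$ the Schmidt metric $|\theta|^2+\|\omega\|^2$. Here $|\cdot|$ is the standard Euclidean norm on $\mathbb{R}^4$ and $\|\cdot\|$ on $\mathfrak{l}$ is the Euclidean norm with respect to a fixed basis of $\mathfrak{l}$ such that $\|a\|\ge\sup_{|X|=1}|aX|$ for all $a\in\mathfrak{l}$ (for instance the standard basis of boosts and rotations). The b-length of a $C^1$ curve in $OM$ is its length in the Schmidt metric, and $B_\rho(F)$ is the open ball in $OM$ with centre $F$ and radius $\rho$ for the distance defined by b-lengths. Let $E_p\in OM$ be a frame at $p\in M$ and let $\mathcal{V}\subseteq B_\rho(E_p)$ be a set such that every $F\in\mathcal{V}$ can be joined to $E_p$ by a $C^1$ curve that lies in $\mathcal{V}$ and has b-length less than $\rho$ (for $\mathcal{V}=B_\rho(E_p)$ this is automatic).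 Let $E$ be a smooth pseudo-orthonormal frame field on an open set that contains $\pi(\mathcal{V})$, with $E(p)=E_p$. Let $\Gamma^i{}_{kl}$ be its rotation coefficients, $\nabla_{E_k}E_l=\sum_i\Gamma^i{}_{kl}E_i$, let $\|\Gamma\|=\sup\{|\sum_{i,k,l}\Gamma^i{}_{kl}X_iY^kZ^l| : |X|=|Y|=|Z|=1\}$ at each point, and put $$K:=\max\Bigl\{\sup_{\pi(\mathcal{V})}\|\Gamma\|,\,1\Bigr\}\in[1,\infty].$$ If $\rho\le \frac{1}{4K}$ (where $\frac{1}{4K}=0$ if $K=\infty$), then every frame $F\in\mathcal{V}$ can be written as $F=E(\pi(F))\,\mathbf{L}$ with $\mathbf{L}$ in the identity component of the Lorentz group $O(1,3)$ and $\|\mathbf{L}\|=\sup_{|X|=1}|\mathbf{L}X|<2$. -/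

import Mathlib

open Set MeasureTheory Bundle
open scoped Manifold ContDiff ENNReal Matrix

noncomputable section

namespace SpaceTime

/-- The model space `ℝ⁴` with its Euclidean norm. -/
abbrev R4 : Type := EuclideanSpace ℝ (Fin 4)

/-- The diagonal `(-1, 1, 1, 1)` of the Minkowski matrix. -/
def sgn : Fin 4 → ℝ := ![-1, 1, 1, 1]

/-- The Minkowski matrix `η = diag(-1, 1, 1, 1)`. -/
def minkowski : Matrix (Fin 4) (Fin 4) ℝ := Matrix.diagonal sgn

/-- The identity component of the Lorentz group (the proper orthochronous Lorentz group). -/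
def lorentzGroup : Set (Matrix (Fin 4) (Fin 4) ℝ) :=
  {L | Lᵀ * minkowski * L = minkowski ∧ L.det = 1 ∧ 0 < L 0 0}

/-- The Lie algebra of the Lorentz group: all matrices `A` with `Aᵀ η = -η A`. -/
abbrev lorentzAlgebra : Submodule ℝ (Matrix (Fin 4) (Fin 4) ℝ) :=
  skewAdjointMatricesSubmodule minkowski

/-- The Euclidean norm on the Lorentz algebra with respect to a basis `b`. -/
def algNorm (b : Module.Basis (Fin 6) ℝ lorentzAlgebra) (a : lorentzAlgebra) : ℝ :=
  Real.sqrt (∑ i, (b.repr a i) ^ 2)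

/-- The mapping norm `sup {|A X| : |X| = 1}` of a matrix, for the Euclidean norm on `ℝ⁴`. -/
def mapNorm (A : Matrix (Fin 4) (Fin 4) ℝ) : ℝ :=
  ‖Matrix.toEuclideanCLM (n := Fin 4) (𝕜 := ℝ) A‖

/-- The projection `A ↦ (A - η Aᵀ η) / 2` of the matrices onto the Lorentz algebra; it is the
identity on the Lorentz algebra. -/
def toAlgebra (A : Matrix (Fin 4) (Fin 4) ℝ) : lorentzAlgebra :=
  ⟨(1 / 2 : ℝ) • (A - minkowski * Aᵀ * minkowski), by
    have h1 : minkowski * minkowski = 1 := by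
      rw [minkowski, Matrix.diagonal_mul_diagonal, ← Matrix.diagonal_one]
      congr 1
      funext i
      fin_cases i <;> simp [sgn]
    have h2 : minkowskiᵀ = minkowski := Matrix.diagonal_transpose _
    rw [mem_skewAdjointMatricesSubmodule,
      Matrix.IsSkewAdjoint, Matrix.IsAdjointPair]
    simp only [Matrix.transpose_smul, Matrix.transpose_sub, Matrix.transpose_mul,
      Matrix.transpose_transpose, h2, Matrix.smul_mul, Matrix.sub_mul, Matrix.mul_neg,
      Matrix.mul_smul, Matrix.mul_sub]
    have h3 : minkowski * (A * minkowski) * minkowski = minkowski * A := by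
      rw [Matrix.mul_assoc, Matrix.mul_assoc, h1, Matrix.mul_one]
    have h4 : minkowski * (minkowski * Aᵀ * minkowski) = Aᵀ * minkowski := by
      rw [← Matrix.mul_assoc, ← Matrix.mul_assoc, h1, Matrix.one_mul]
    rw [h3, h4, ← smul_neg, neg_sub]⟩

theorem toAlgebra_coe (a : lorentzAlgebra) : toAlgebra (a : Matrix (Fin 4) (Fin 4) ℝ) = a := by
  have h1 : minkowski * minkowski = 1 := by
    rw [minkowski, Matrix.diagonal_mul_diagonal, ← Matrix.diagonal_one]
    congr 1
    funext i
    fin_cases i <;> simp [sgn]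
  obtain ⟨A, hA⟩ := a
  apply Subtype.ext
  have hA' := hA
  rw [mem_skewAdjointMatricesSubmodule,
    Matrix.IsSkewAdjoint, Matrix.IsAdjointPair] at hA'
  have h2 : minkowski * Aᵀ * minkowski = -A := by
    rw [Matrix.mul_assoc, hA', ← Matrix.mul_assoc, h1, Matrix.one_mul]
  change (1 / 2 : ℝ) • (A - minkowski * Aᵀ * minkowski) = A
  rw [h2, sub_neg_eq_add, ← two_smul ℝ A, smul_smul]
  norm_num

section

variable {M : Type*} [TopologicalSpace M] [ChartedSpace R4 M] [IsManifold (𝓡 4) ∞ M]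

variable (M) in
/-- A smooth metric of signature `(- + + +)` on the 4-manifold `M`. -/
structure LorentzMetric where
  /-- the metric at a point -/
  val (x : M) : TangentSpace (𝓡 4) x →L[ℝ] TangentSpace (𝓡 4) x →L[ℝ] ℝ
  symm (x : M) (u v : TangentSpace (𝓡 4) x) : val x u v = val x v u
  signature (x : M) : ∃ e : Fin 4 → TangentSpace (𝓡 4) x,
    ∀ i j, val x (e i) (e j) = minkowski i j
  contMDiff : ContMDiff (𝓡 4) ((𝓡 4).prod 𝓘(ℝ, R4 →L[ℝ] R4 →L[ℝ] ℝ)) ∞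
    (fun x ↦ TotalSpace.mk' (R4 →L[ℝ] R4 →L[ℝ] ℝ)
      (E := fun x : M ↦ TangentSpace (𝓡 4) x →L[ℝ] TangentSpace (𝓡 4) x →L[ℝ] ℝ) x (val x))

/-- `e` is a pseudo-orthonormal frame at `x`. -/
def IsFrameAt (g : LorentzMetric M) (x : M) (e : Fin 4 → TangentSpace (𝓡 4) x) : Prop :=
  ∀ i j, g.val x (e i) (e j) = minkowski i j

variable (M) in
/-- The coordinates `R4` of the vector `v` at `y`, in the chart of `M` preferred at `x`. -/
def inChart (x y : M) (v : TangentSpace (𝓡 4) y) : R4 :=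
  (trivializationAt R4 (TangentSpace (𝓡 4) : M → Type) x ⟨y, v⟩).2

/-- The value at `y` of the vector field with constant components `v` in the chart preferred
at `x`. At `y = x` it is `v` itself. -/
def coordField (x y : M) (v : R4) : TangentSpace (𝓡 4) y :=
  (trivializationAt R4 (TangentSpace (𝓡 4) : M → Type) x).symmL ℝ y v

/-- The `k`-th coordinate vector at `x`, for the chart preferred at `x`. -/
def coordVec (x : M) (k : Fin 4) : TangentSpace (𝓡 4) x :=
  (EuclideanSpace.single k (1 : ℝ) : R4)

/-- The derivative at `x` in the direction `u` of the metric coefficient `g(v, w)`, where `v` and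
`w` are continued with constant components in the chart preferred at `x`. -/
def metricDeriv (g : LorentzMetric M) (x : M) (u v w : TangentSpace (𝓡 4) x) : ℝ :=
  mvfderiv (𝓡 4) (fun y : M ↦ g.val y (coordField x y v) (coordField x y w)) x u

/-- The matrix of the metric coefficients at `x`, in the chart preferred at `x`. -/
def metricMatrix (g : LorentzMetric M) (x : M) : Matrix (Fin 4) (Fin 4) ℝ :=
  Matrix.of fun k l ↦ g.val x (coordVec x k) (coordVec x l)

/-- The Christoffel symbols of the Levi-Civita connection at `x`, in the chart preferred at `x`, as
a bilinear map: `Γᵏ(u, v) = ½ gᵏˡ (∂ᵤ g(v, ∂ₗ) + ∂ᵥ g(u, ∂ₗ) - ∂ₗ g(u, v))`. -/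
def christoffel (g : LorentzMetric M) (x : M) (u v : TangentSpace (𝓡 4) x) :
    TangentSpace (𝓡 4) x :=
  ∑ k, ((1 / 2 : ℝ) * ∑ l, (metricMatrix g x)⁻¹ k l *
    (metricDeriv g x u v (coordVec x l) + metricDeriv g x v u (coordVec x l)
      - metricDeriv g x (coordVec x l) u v)) • coordVec x k

/-- The Levi-Civita covariant derivative at `x` of the vector field `Y` in the direction `v`. -/
def covDeriv (g : LorentzMetric M) (Y : ∀ x : M, TangentSpace (𝓡 4) x) (x : M)
    (v : TangentSpace (𝓡 4) x) : TangentSpace (𝓡 4) x :=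
  let dY : TangentSpace (𝓡 4) x := mvfderiv (𝓡 4) (fun y : M ↦ inChart M x y (Y y)) x v
  dY + christoffel g x v (Y x)

/-- The velocity at time `t` of a curve in `M` that is parametrised by `[0, 1]`. -/
def velocity (c : ℝ → M) (t : ℝ) : TangentSpace (𝓡 4) (c t) :=
  mfderivWithin 𝓘(ℝ, ℝ) (𝓡 4) c (Icc 0 1) t (1 : ℝ)

/-- The Levi-Civita covariant derivative of the vector field `X` along the curve `c`. -/
def covDerivAlong (g : LorentzMetric M) (c : ℝ → M) (X : ∀ t, TangentSpace (𝓡 4) (c t)) (t : ℝ) :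
    TangentSpace (𝓡 4) (c t) :=
  let dX : TangentSpace (𝓡 4) (c t) :=
    derivWithin (fun s ↦ inChart M (c t) (c s) (X s)) (Icc 0 1) t
  dX + christoffel g (c t) (velocity c t) (X t)

/-- The components of the vector `v` in the pseudo-orthonormal frame `e`. -/
def frameComp (g : LorentzMetric M) {x : M} (e : Fin 4 → TangentSpace (𝓡 4) x)
    (v : TangentSpace (𝓡 4) x) : R4 :=
  WithLp.toLp 2 fun i ↦ sgn i * g.val x (e i) v

/-- The bundle `OM` of pseudo-orthonormal frames. -/
structure OM (g : LorentzMetric M) where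
  /-- the base point `π(F)` -/
  base : M
  /-- the vectors of the frame -/
  vec : Fin 4 → TangentSpace (𝓡 4) base
  isFrame : IsFrameAt g base vec

/-- `κ` is a `C¹` curve in `OM`, parametrised by `[0, 1]`. -/
def IsC1Curve {g : LorentzMetric M} (κ : ℝ → OM g) : Prop :=
  ∀ i, ContMDiffOn 𝓘(ℝ, ℝ) (𝓡 4).tangent 1
    (fun t ↦ (⟨(κ t).base, (κ t).vec i⟩ : TangentBundle (𝓡 4) M)) (Icc 0 1)

/-- The canonical form `θ` on the tangent vector of the curve `κ` in `OM`: the components of the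
velocity of `π ∘ κ` in the frame `κ(t)`. -/
def canonicalForm {g : LorentzMetric M} (κ : ℝ → OM g) (t : ℝ) : R4 :=
  frameComp g (κ t).vec (velocity (fun s ↦ (κ s).base) t)

/-- The matrix `a` with `∇F_j = ∑ i, a i j • F_i` at time `t`, where `F = κ` and `∇` is the
covariant derivative along `π ∘ κ`. -/
def connectionMatrix {g : LorentzMetric M} (κ : ℝ → OM g) (t : ℝ) : Matrix (Fin 4) (Fin 4) ℝ :=
  Matrix.of fun i j ↦
    frameComp g (κ t).vec (covDerivAlong g (fun s ↦ (κ s).base) (fun s ↦ (κ s).vec j) t) i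

/-- The connection form `ω` on the tangent vector of the curve `κ` in `OM`, the element `a` of the
Lorentz algebra for which `F a` is the vertical part `∇F` of the tangent vector. For a `C¹` curve
the matrix `connectionMatrix κ t` lies in the Lorentz algebra since the connection is metric, so
that `toAlgebra` does not change it; it only supplies the type. -/
def connectionForm {g : LorentzMetric M} (κ : ℝ → OM g) (t : ℝ) : lorentzAlgebra :=
  toAlgebra (connectionMatrix κ t)

/-- The length of the tangent vector of `κ` in the Schmidt metric `|θ|² + |ω|²` of `OM`. -/
def schmidtSpeed {g : LorentzMetric M} (b : Module.Basis (Fin 6) ℝ lorentzAlgebra) (κ : ℝ → OM g)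
    (t : ℝ) : ℝ :=
  Real.sqrt (‖canonicalForm κ t‖ ^ 2 + algNorm b (connectionForm κ t) ^ 2)

/-- The b-length of `κ`. -/
def bLength {g : LorentzMetric M} (b : Module.Basis (Fin 6) ℝ lorentzAlgebra) (κ : ℝ → OM g) :
    ℝ≥0∞ :=
  ∫⁻ t in Icc (0 : ℝ) 1, ENNReal.ofReal (schmidtSpeed b κ t)

/-- The b-distance of two frames inside `V`: the infimum of the b-lengths of the curves in `V` that
join them. -/
def bDistIn {g : LorentzMetric M} (b : Module.Basis (Fin 6) ℝ lorentzAlgebra) (V : Set (OM g))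
    (F₀ F₁ : OM g) : ℝ≥0∞ :=
  ⨅ (κ : ℝ → OM g) (_ : IsC1Curve κ) (_ : MapsTo κ (Icc 0 1) V) (_ : κ 0 = F₀) (_ : κ 1 = F₁),
    bLength b κ

/-- The open b-ball in `OM`. -/
def bBall {g : LorentzMetric M} (b : Module.Basis (Fin 6) ℝ lorentzAlgebra) (F₀ : OM g) (ρ : ℝ) :
    Set (OM g) :=
  {F | bDistIn b univ F₀ F < ENNReal.ofReal ρ}

/-- The rotation coefficients `Γⁱ_{kl}` of the frame field `E` at `x`, that is
`∇_{E_k} E_l = ∑ i, Γⁱ_{kl} E_i`. -/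
def rotationCoeff (g : LorentzMetric M) (E : ∀ x : M, Fin 4 → TangentSpace (𝓡 4) x) (x : M)
    (i k l : Fin 4) : ℝ :=
  frameComp g (E x) (covDeriv g (fun y ↦ E y l) x (E x k)) i

/-- The mapping norm of the array of the rotation coefficients of `E` at `x`. -/
def rotationNorm (g : LorentzMetric M) (E : ∀ x : M, Fin 4 → TangentSpace (𝓡 4) x) (x : M) :
    ℝ≥0∞ :=
  ⨆ (X : R4) (Y : R4) (Z : R4) (_ : ‖X‖ = 1 ∧ ‖Y‖ = 1 ∧ ‖Z‖ = 1),
    ENNReal.ofReal |∑ i, ∑ k, ∑ l, rotationCoeff g E x i k l * X i * Y k * Z l|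

/-- `E` is a smooth pseudo-orthonormal frame field on the open set `U`. -/
structure IsFrameField (g : LorentzMetric M) (U : Set M)
    (E : ∀ x : M, Fin 4 → TangentSpace (𝓡 4) x) : Prop where
  isOpen : IsOpen U
  isFrame : ∀ x ∈ U, IsFrameAt g x (E x)
  smooth : ∀ i, ContMDiffOn (𝓡 4) (𝓡 4).tangent ∞
    (fun x ↦ (⟨x, E x i⟩ : TangentBundle (𝓡 4) M)) U

/-- The constant `K = max {sup ‖Γ‖, 1}`, where the supremum is taken over `π(V)`. -/
def rotationBound {g : LorentzMetric M} (E : ∀ x : M, Fin 4 → TangentSpace (𝓡 4) x)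
    (V : Set (OM g)) : ℝ≥0∞ :=
  max (⨆ F ∈ V, rotationNorm g E F.base) 1

end

end SpaceTime

end

/-!
Join `E_p` to `F` by a `C¹` curve `κ` in `V` of b-length less than `ρ` and write `κ = E L` along it,
with a curve `L` of Lorentz matrices that starts at the identity; the entries of `L` are the
components of the frame `κ` in the frame `E` (`transition`). By continuity `L` stays in the identity
component (`mem_lorentzGroup_of_path`), since Lorentz matrices have `det L = ± 1` and `L₀₀² ≥ 1`.

For the norm, let `θ` and `ω` be the values of the canonical form and of the connection form on the
tangent vector of `κ`. The velocity of `π ∘ κ` has components `L θ` in the frame `E`, and expressing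
`∇κ_j` once through `κ` and once through `E` gives `L ω = L' + Γ(L θ) L`, that is
`L' = L ω - Γ(L θ) L` (`hasDerivWithinAt_transition`). As `|L| ≥ 1` and `K ≥ 1`, this implies
`|L'| ≤ K |L|² (|ω| + |θ|) ≤ √2 K |L|² σ`, where `σ` is the speed of `κ` in the Schmidt metric
(`mapNorm_transitionDeriv_le`). Thus `1 / |L|` decreases by at most `√2 K ρ ≤ √2 / 4 < 1 / 2` along
`κ`, and `|L| < 2` at its end. As the norm is not differentiable, the last step compares `|L|` with
a solution of the differential equation `B' = h B²` (`norm_lt_two_of_lintegral_lt`).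

The connection is given by Christoffel symbols in charts. All that is used of it is linearity in the
direction of differentiation, the chain rule for fields along curves (`covDerivAlong_comp`), and the
product rule for scalar products along curves (`hasDerivWithinAt_val`), which rests on
`∂ᵤ g(v, w) = g(Γ(u, v), w) + g(v, Γ(u, w))` (`metricDeriv_eq_christoffel`). The product rule also
shows that the connection matrix of a curve lies in the Lorentz algebra (`connectionMatrix_mem`), so
that `connectionForm` does not alter it.
-/

noncomputable section

namespace SpaceTime

open Filter Topology

/-! ### The metric in a chart -/

/-- A shortcut for the instance search on the space of bilinear forms. -/
instance (priority := 2000) normedAddCommGroupBilin : NormedAddCommGroup (R4 →L[ℝ] R4 →L[ℝ] ℝ) :=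
  ContinuousLinearMap.toNormedAddCommGroup

/-- A shortcut for the instance search on the space of bilinear forms. -/
instance (priority := 2000) normedSpaceBilin : NormedSpace ℝ (R4 →L[ℝ] R4 →L[ℝ] ℝ) :=
  ContinuousLinearMap.toNormedSpace

/-- Evaluation of bilinear forms on `ℝ⁴` at a pair of vectors. -/
def evalTwo (v w : R4) : (R4 →L[ℝ] R4 →L[ℝ] ℝ) →L[ℝ] ℝ :=
  (ContinuousLinearMap.apply ℝ ℝ w).comp (ContinuousLinearMap.apply ℝ (R4 →L[ℝ] ℝ) v)

section

variable {M : Type*} [TopologicalSpace M] [ChartedSpace R4 M] [IsManifold (𝓡 4) ∞ M]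

theorem mem_baseSet_self (x : M) :
    x ∈ (trivializationAt R4 (TangentSpace (𝓡 4) : M → Type) x).baseSet :=
  FiberBundle.mem_baseSet_trivializationAt' x

theorem inChart_self (x : M) (v : TangentSpace (𝓡 4) x) : inChart M x x v = v := by
  unfold inChart
  rw [TangentBundle.trivializationAt_apply]
  have h := (tangentBundleCore (𝓡 4) M).coordChange_self (achart R4 x) x (by simp) v
  rw [tangentBundleCore_coordChange_achart] at h
  exact h

theorem coordField_inChart {x y : M}
    (hy : y ∈ (trivializationAt R4 (TangentSpace (𝓡 4) : M → Type) x).baseSet)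
    (v : TangentSpace (𝓡 4) y) : coordField x y (inChart M x y v) = v := by
  unfold coordField inChart
  rw [Bundle.Trivialization.symmL_apply _ hy]
  exact Bundle.Trivialization.symm_proj_apply _ (⟨y, v⟩ : TangentBundle (𝓡 4) M) hy

theorem coordField_self (x : M) (v : R4) : coordField x x v = v := by
  have h := coordField_inChart (mem_baseSet_self x) (v : TangentSpace (𝓡 4) x)
  erw [inChart_self] at h
  exact h

/-- The metric at `y` as a bilinear form on `ℝ⁴`, read in the chart preferred at `x`. -/
def coordMetric (g : LorentzMetric M) (x y : M) : R4 →L[ℝ] R4 →L[ℝ] ℝ :=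
  let S : R4 →L[ℝ] TangentSpace (𝓡 4) y :=
    (trivializationAt R4 (TangentSpace (𝓡 4) : M → Type) x).symmL ℝ y
  (S.precomp ℝ).comp ((g.val y).comp S)

theorem coordMetric_apply (g : LorentzMetric M) (x y : M) (v w : R4) :
    coordMetric g x y v w = g.val y (coordField x y v) (coordField x y w) := rfl

theorem mdifferentiableAt_coordMetric (g : LorentzMetric M) (x : M) :
    MDifferentiableAt (𝓡 4) 𝓘(ℝ, R4 →L[ℝ] R4 →L[ℝ] ℝ) (coordMetric g x) x := by
  have h := (g.contMDiff x).mdifferentiableAt (by simp)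
  have h2 := ((mdifferentiableAt_hom_bundle _ ).1 h).2
  refine h2.congr_of_eventuallyEq ?_
  have hb := (trivializationAt R4 (TangentSpace (𝓡 4) : M → Type) x).open_baseSet.mem_nhds
    (mem_baseSet_self x)
  filter_upwards [hb] with y hy
  ext v w
  refine Eq.trans ?_ (inCoordinates_apply_eq₂ hy hy (mem_univ _)).symm
  simp [coordMetric_apply, coordField, Bundle.Trivialization.symmL_apply _ hy]

omit [IsManifold (𝓡 4) ∞ M] in
theorem mvfderiv_clm_comp {W : Type*} [NormedAddCommGroup W] [NormedSpace ℝ W] (ev : W →L[ℝ] ℝ)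
    {f : M → W} {x : M} (hf : MDifferentiableAt (𝓡 4) 𝓘(ℝ, W) f x) (u : TangentSpace (𝓡 4) x) :
    mvfderiv (𝓡 4) (fun y ↦ ev (f y)) x u = ev (mvfderiv (𝓡 4) f x u) := by
  have h : HasMFDerivAt 𝓘(ℝ, W) 𝓘(ℝ, ℝ) ev (f x) ev := ev.hasFDerivAt.hasMFDerivAt
  exact congrArg (fun T ↦ T u) (h.comp x hf.hasMFDerivAt).mfderiv

theorem metricDeriv_eq (g : LorentzMetric M) (x : M) (u v w : TangentSpace (𝓡 4) x) :
    metricDeriv g x u v w = mvfderiv (𝓡 4) (coordMetric g x) x u v w :=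
  mvfderiv_clm_comp (evalTwo v w) (mdifferentiableAt_coordMetric g x) u

end

/-! ### Christoffel symbols, metricity and pseudo-orthonormal frames -/

section

variable {M : Type*} [TopologicalSpace M] [ChartedSpace R4 M] [IsManifold (𝓡 4) ∞ M]

theorem metricDeriv_add_left (g : LorentzMetric M) (x : M) (u u' v w : TangentSpace (𝓡 4) x) :
    metricDeriv g x (u + u') v w = metricDeriv g x u v w + metricDeriv g x u' v w := by
  simp only [metricDeriv, map_add]

theorem metricDeriv_smul_left (g : LorentzMetric M) (x : M) (a : ℝ)
    (u v w : TangentSpace (𝓡 4) x) :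
    metricDeriv g x (a • u) v w = a * metricDeriv g x u v w := by
  simp only [metricDeriv, map_smul, smul_eq_mul]

theorem metricDeriv_add_right (g : LorentzMetric M) (x : M) (u v w w' : TangentSpace (𝓡 4) x) :
    metricDeriv g x u v (w + w') = metricDeriv g x u v w + metricDeriv g x u v w' := by
  simp only [metricDeriv_eq]
  exact map_add (mvfderiv (𝓡 4) (coordMetric g x) x u v) w w'

theorem metricDeriv_smul_right (g : LorentzMetric M) (x : M) (a : ℝ)
    (u v w : TangentSpace (𝓡 4) x) :
    metricDeriv g x u v (a • w) = a * metricDeriv g x u v w := by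
  simp only [metricDeriv_eq]
  exact map_smul (mvfderiv (𝓡 4) (coordMetric g x) x u v) a w

theorem metricDeriv_symm (g : LorentzMetric M) (x : M) (u v w : TangentSpace (𝓡 4) x) :
    metricDeriv g x u v w = metricDeriv g x u w v := by
  unfold metricDeriv
  congr 2
  funext y
  exact g.symm y _ _

/-- The covector `w ↦ ½ (∂ᵤ g(v, w) + ∂ᵥ g(u, w) - ∂_w g(u, v))`, a Christoffel symbol of the first
kind. -/
def christoffelFirst (g : LorentzMetric M) (x : M) (u v : TangentSpace (𝓡 4) x) :
    TangentSpace (𝓡 4) x →ₗ[ℝ] ℝ where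
  toFun w := (1 / 2 : ℝ) * (metricDeriv g x u v w + metricDeriv g x v u w - metricDeriv g x w u v)
  map_add' w w' := by
    simp only [metricDeriv_add_right, metricDeriv_add_left]
    ring
  map_smul' a w := by
    simp only [metricDeriv_smul_right, metricDeriv_smul_left, RingHom.id_apply, smul_eq_mul]
    ring

omit [IsManifold (𝓡 4) ∞ M] in
theorem exists_eq_sum_coordVec (x : M) (v : TangentSpace (𝓡 4) x) :
    ∃ c : Fin 4 → ℝ, v = ∑ k, c k • coordVec x k := by
  let v' : R4 := v
  have h := (EuclideanSpace.basisFun (Fin 4) ℝ).sum_repr v'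
  simp only [EuclideanSpace.basisFun_repr, EuclideanSpace.basisFun_apply] at h
  exact ⟨fun k ↦ v' k, h.symm⟩

theorem sgn_mul_self (i : Fin 4) : sgn i * sgn i = 1 := by
  fin_cases i <;> simp [sgn]

theorem minkowski_apply (i j : Fin 4) : minkowski i j = if i = j then sgn i else 0 :=
  Matrix.diagonal_apply _ _ _

theorem minkowski_mul_self : minkowski * minkowski = 1 := by
  rw [minkowski, Matrix.diagonal_mul_diagonal, ← Matrix.diagonal_one]
  exact congrArg Matrix.diagonal (funext sgn_mul_self)

theorem isUnit_det_metricMatrix (g : LorentzMetric M) (x : M) :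
    IsUnit (metricMatrix g x).det := by
  obtain ⟨e, he⟩ := g.signature x
  choose c hc using fun i ↦ exists_eq_sum_coordVec x (e i)
  let P : Matrix (Fin 4) (Fin 4) ℝ := Matrix.of fun k i ↦ c i k
  have h : Pᵀ * metricMatrix g x * P = minkowski := by
    ext i j
    rw [← he i j]
    conv_rhs => rw [hc i, hc j]
    simp only [map_sum, map_smul, sum_apply, smul_apply,
      smul_eq_mul, Matrix.mul_apply, Matrix.transpose_apply, Finset.sum_mul]
    refine Finset.sum_congr rfl fun k _ ↦ ?_
    rw [Finset.mul_sum]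
    refine Finset.sum_congr rfl fun l _ ↦ ?_
    simp only [P, metricMatrix, Matrix.of_apply]
    ring
  have h3 : IsUnit (Pᵀ * metricMatrix g x * P).det := by
    rw [h]
    exact IsUnit.of_mul_eq_one minkowski.det
      (by rw [← Matrix.det_mul, minkowski_mul_self, Matrix.det_one])
  rw [Matrix.det_mul, Matrix.det_mul] at h3
  exact isUnit_of_mul_isUnit_right (isUnit_of_mul_isUnit_left h3)

/-- Lowering the upper index of the Christoffel symbols gives those of the first kind. -/
theorem val_christoffel (g : LorentzMetric M) (x : M) (u v w : TangentSpace (𝓡 4) x) :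
    g.val x w (christoffel g x u v) = christoffelFirst g x u v w := by
  have key : ∀ m, g.val x (coordVec x m) (christoffel g x u v)
      = christoffelFirst g x u v (coordVec x m) := by
    intro m
    have h1 : metricMatrix g x * (metricMatrix g x)⁻¹ = 1 :=
      Matrix.mul_nonsing_inv _ (isUnit_det_metricMatrix g x)
    let T : Fin 4 → ℝ := fun l ↦ christoffelFirst g x u v (coordVec x l)
    have h2 : (metricMatrix g x * (metricMatrix g x)⁻¹).mulVec T m = T m := by
      rw [h1, Matrix.one_mulVec]
    rw [← Matrix.mulVec_mulVec] at h2
    refine Eq.trans ?_ h2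
    unfold christoffel
    simp only [map_sum, map_smul, smul_eq_mul, Matrix.mulVec, dotProduct]
    refine Finset.sum_congr rfl fun k _ ↦ ?_
    rw [mul_comm, Finset.mul_sum]
    congr 1
    refine Finset.sum_congr rfl fun l _ ↦ ?_
    simp only [T, christoffelFirst, LinearMap.coe_mk, AddHom.coe_mk]
    ring
  obtain ⟨c, rfl⟩ := exists_eq_sum_coordVec x w
  simp only [map_sum, map_smul, sum_apply, smul_apply, key]

/-- The Levi-Civita connection is metric. -/
theorem metricDeriv_eq_christoffel (g : LorentzMetric M) (x : M) (u v w : TangentSpace (𝓡 4) x) :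
    metricDeriv g x u v w
      = g.val x (christoffel g x u v) w + g.val x v (christoffel g x u w) := by
  rw [g.symm x _ w, val_christoffel, val_christoffel]
  simp only [christoffelFirst, LinearMap.coe_mk, AddHom.coe_mk]
  rw [metricDeriv_symm g x u w v, metricDeriv_symm g x w u v, metricDeriv_symm g x v u w]
  ring

theorem IsFrameAt.eq_sum {g : LorentzMetric M} {x : M} {e : Fin 4 → TangentSpace (𝓡 4) x}
    (he : IsFrameAt g x e) (v : TangentSpace (𝓡 4) x) : v = ∑ i, frameComp g e v i • e i := by
  have hsum : ∀ (c : Fin 4 → ℝ) (i : Fin 4), sgn i * g.val x (e i) (∑ j, c j • e j) = c i := by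
    intro c i
    simp only [map_sum, map_smul, smul_eq_mul, he i, minkowski_apply, mul_ite, mul_zero,
      Finset.sum_ite_eq, Finset.mem_univ, if_true]
    rw [mul_comm (c i), ← mul_assoc, sgn_mul_self, one_mul]
  have hli : LinearIndependent ℝ e := by
    rw [Fintype.linearIndependent_iff]
    intro c hc i
    rw [← hsum c i, hc, map_zero, mul_zero]
  have hcard : Fintype.card (Fin 4) = Module.finrank ℝ (TangentSpace (𝓡 4) x) := by
    change _ = Module.finrank ℝ R4
    simp
  let B := basisOfLinearIndependentOfCardEqFinrank hli hcard
  have hv := B.sum_repr v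
  simp only [B, coe_basisOfLinearIndependentOfCardEqFinrank] at hv
  conv_lhs => rw [← hv]
  refine Finset.sum_congr rfl fun i _ ↦ ?_
  rw [← hsum (fun j ↦ B.repr v j) i, hv]
  rfl

/-- Two vectors with the same scalar products agree, as the metric is nondegenerate. -/
theorem eq_of_val_eq {g : LorentzMetric M} {x : M} {v w : TangentSpace (𝓡 4) x}
    (h : ∀ z, g.val x z v = g.val x z w) : v = w := by
  obtain ⟨e, he⟩ := g.signature x
  rw [IsFrameAt.eq_sum he v, IsFrameAt.eq_sum he w]
  refine Finset.sum_congr rfl fun i _ ↦ ?_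
  simp only [frameComp, h]

theorem christoffel_add_left (g : LorentzMetric M) (x : M) (u u' v : TangentSpace (𝓡 4) x) :
    christoffel g x (u + u') v = christoffel g x u v + christoffel g x u' v := by
  refine eq_of_val_eq (g := g) fun z ↦ ?_
  rw [map_add]
  simp only [val_christoffel, christoffelFirst, LinearMap.coe_mk, AddHom.coe_mk]
  rw [metricDeriv_symm g x v _ z, metricDeriv_symm g x z _ v]
  simp only [metricDeriv_add_left, metricDeriv_add_right]
  rw [metricDeriv_symm g x v u z, metricDeriv_symm g x z u v,
    metricDeriv_symm g x v u' z, metricDeriv_symm g x z u' v]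
  ring

theorem christoffel_smul_left (g : LorentzMetric M) (x : M) (a : ℝ)
    (u v : TangentSpace (𝓡 4) x) :
    christoffel g x (a • u) v = a • christoffel g x u v := by
  refine eq_of_val_eq (g := g) fun z ↦ ?_
  rw [map_smul]
  simp only [val_christoffel, christoffelFirst, LinearMap.coe_mk, AddHom.coe_mk]
  rw [metricDeriv_symm g x v _ z, metricDeriv_symm g x z _ v]
  simp only [metricDeriv_smul_left, metricDeriv_smul_right]
  rw [metricDeriv_symm g x v u z, metricDeriv_symm g x z u v, smul_eq_mul]
  ring

/-- The covariant derivative of a vector field at a point, as a linear map of the direction. -/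
def covDerivLin (g : LorentzMetric M) (Y : ∀ x : M, TangentSpace (𝓡 4) x) (x : M) :
    TangentSpace (𝓡 4) x →ₗ[ℝ] TangentSpace (𝓡 4) x where
  toFun := covDeriv g Y x
  map_add' u v := by
    simp only [covDeriv, christoffel_add_left]
    rw [map_add]
    exact add_add_add_comm _ _ _ _
  map_smul' a u := by
    simp only [covDeriv, christoffel_smul_left, RingHom.id_apply]
    rw [map_smul]
    exact (smul_add a _ _).symm

end

/-! ### Covariant derivatives along curves -/

section

variable {M : Type*} [TopologicalSpace M] [ChartedSpace R4 M]

/-- Chain rule for a vector-valued function on `M` along a curve. -/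
theorem hasDerivWithinAt_comp_curve {W : Type*} [NormedAddCommGroup W] [NormedSpace ℝ W]
    {f : M → W} {c : ℝ → M} {t : ℝ} (hf : MDifferentiableAt (𝓡 4) 𝓘(ℝ, W) f (c t))
    (hc : MDifferentiableWithinAt 𝓘(ℝ, ℝ) (𝓡 4) c (Icc 0 1) t) :
    HasDerivWithinAt (fun s ↦ f (c s)) (mvfderiv (𝓡 4) f (c t) (velocity c t)) (Icc 0 1) t := by
  have h := hf.hasMFDerivAt.comp_hasMFDerivWithinAt t hc.hasMFDerivWithinAt
  let T : ℝ →L[ℝ] W :=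
    (mvfderiv (𝓡 4) f (c t)).comp (mfderivWithin 𝓘(ℝ, ℝ) (𝓡 4) c (Icc 0 1) t)
  have h2 : HasFDerivWithinAt (fun s ↦ f (c s)) T (Icc 0 1) t :=
    hasMFDerivWithinAt_iff_hasFDerivWithinAt.1 h
  exact h2.hasDerivWithinAt

variable [IsManifold (𝓡 4) ∞ M]

/-- The vector field `X` along the curve `c` is differentiable at time `t`. -/
def DiffAlong (c : ℝ → M) (X : ∀ t, TangentSpace (𝓡 4) (c t)) (t : ℝ) : Prop :=
  MDifferentiableWithinAt 𝓘(ℝ, ℝ) (𝓡 4).tangent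
    (fun s ↦ (⟨c s, X s⟩ : TangentBundle (𝓡 4) M)) (Icc 0 1) t

theorem DiffAlong.curve {c : ℝ → M} {X : ∀ t, TangentSpace (𝓡 4) (c t)} {t : ℝ}
    (h : DiffAlong c X t) : MDifferentiableWithinAt 𝓘(ℝ, ℝ) (𝓡 4) c (Icc 0 1) t :=
  ((mdifferentiableWithinAt_totalSpace ..).1 h).1

theorem DiffAlong.hasDerivWithinAt_inChart {c : ℝ → M} {X : ∀ t, TangentSpace (𝓡 4) (c t)} {t : ℝ}
    (h : DiffAlong c X t) :
    HasDerivWithinAt (fun s ↦ inChart M (c t) (c s) (X s))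
      (derivWithin (fun s ↦ inChart M (c t) (c s) (X s)) (Icc 0 1) t) (Icc 0 1) t :=
  DifferentiableWithinAt.hasDerivWithinAt
    (mdifferentiableWithinAt_iff_differentiableWithinAt.1
      ((mdifferentiableWithinAt_totalSpace ..).1 h).2)

/-- Product rule for the scalar product of two vector fields along a curve. -/
theorem hasDerivWithinAt_val (g : LorentzMetric M) {c : ℝ → M}
    {X Y : ∀ t, TangentSpace (𝓡 4) (c t)} {t : ℝ} (hX : DiffAlong c X t) (hY : DiffAlong c Y t)
    (ht : t ∈ Icc (0 : ℝ) 1) :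
    HasDerivWithinAt (fun s ↦ g.val (c s) (X s) (Y s))
      (g.val (c t) (covDerivAlong g c X t) (Y t) + g.val (c t) (X t) (covDerivAlong g c Y t))
      (Icc 0 1) t := by
  have hG := hasDerivWithinAt_comp_curve (mdifferentiableAt_coordMetric g (c t)) hX.curve
  have h1 := (hG.clm_apply hX.hasDerivWithinAt_inChart).clm_apply hY.hasDerivWithinAt_inChart
  have hev : (fun s ↦ g.val (c s) (X s) (Y s)) =ᶠ[𝓝[Icc 0 1] t] fun s ↦
      coordMetric g (c t) (c s) (inChart M (c t) (c s) (X s)) (inChart M (c t) (c s) (Y s)) := by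
    have hb := (trivializationAt R4 (TangentSpace (𝓡 4) : M → Type) (c t)).open_baseSet.mem_nhds
      (mem_baseSet_self (c t))
    filter_upwards [hX.curve.continuousWithinAt hb] with s hs
    rw [coordMetric_apply, coordField_inChart hs, coordField_inChart hs]
  refine (h1.congr_of_eventuallyEq_of_mem hev ht).congr_deriv ?_
  have hD := metricDeriv_eq g (c t) (velocity c t) (X t) (Y t)
  rw [metricDeriv_eq_christoffel] at hD
  -- `ℝ⁴` and the tangent space at `c t` agree only after unfolding, so the remaining identities are
  -- stated for general arguments and applied up to definitional equality.
  have e1 : ∀ v w : R4, coordMetric g (c t) (c t) v w = g.val (c t) v w := fun v w ↦ by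
    rw [coordMetric_apply, coordField_self, coordField_self]
  have e2 : ∀ (D : R4 →L[ℝ] R4 →L[ℝ] ℝ) (v w v' w' : R4),
      (D v + coordMetric g (c t) (c t) v') w + coordMetric g (c t) (c t) v w'
        = D v w + g.val (c t) v' w + g.val (c t) v w' := fun D v w v' w' ↦ by
    rw [add_apply, e1, e1]
  rw [inChart_self, inChart_self]
  refine (e2 _ _ _ _ _).trans ?_
  simp only [covDerivAlong, map_add, add_apply]
  have e3 : ∀ p q r s D : ℝ, p + q = D → D + r + s = r + p + (s + q) := fun p q r s D h ↦ by
    rw [← h]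
    ring
  exact e3 _ _ _ _ _ hD

/-- The derivative of a vector field along a curve is the covariant derivative in the direction of
the velocity. -/
theorem covDerivAlong_comp (g : LorentzMetric M) {Y : ∀ x : M, TangentSpace (𝓡 4) x} {c : ℝ → M}
    {t : ℝ} (hY : MDifferentiableAt (𝓡 4) (𝓡 4).tangent
      (fun x ↦ (⟨x, Y x⟩ : TangentBundle (𝓡 4) M)) (c t))
    (hc : MDifferentiableWithinAt 𝓘(ℝ, ℝ) (𝓡 4) c (Icc 0 1) t) (ht : t ∈ Icc (0 : ℝ) 1) :
    covDerivAlong g c (fun s ↦ Y (c s)) t = covDeriv g Y (c t) (velocity c t) := by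
  have h1 : MDifferentiableAt (𝓡 4) 𝓘(ℝ, R4) (fun y : M ↦ inChart M (c t) y (Y y)) (c t) :=
    ((mdifferentiableAt_totalSpace ..).1 hY).2
  have h2 := (hasDerivWithinAt_comp_curve h1 hc).derivWithin (uniqueDiffOn_Icc_zero_one t ht)
  exact congrArg (fun v : TangentSpace (𝓡 4) (c t) ↦
    v + christoffel g (c t) (velocity c t) (Y (c t))) h2

theorem val_eq_sum_frameComp {g : LorentzMetric M} {x : M} {e : Fin 4 → TangentSpace (𝓡 4) x}
    (he : IsFrameAt g x e) (v w : TangentSpace (𝓡 4) x) :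
    g.val x v w = ∑ i, frameComp g e v i * g.val x (e i) w := by
  conv_lhs => rw [he.eq_sum v]
  simp only [map_sum, map_smul, sum_apply, smul_apply, smul_eq_mul]

/-- The matrix of the covariant derivative of a pseudo-orthonormal frame along a curve lies in the
Lorentz algebra. -/
theorem skew_of_isFrameAt (g : LorentzMetric M) {c : ℝ → M}
    {X : ∀ t, Fin 4 → TangentSpace (𝓡 4) (c t)} {t : ℝ} (ht : t ∈ Icc (0 : ℝ) 1)
    (hX : ∀ i, DiffAlong c (fun s ↦ X s i) t)
    (hF : ∀ s ∈ Icc (0 : ℝ) 1, IsFrameAt g (c s) (X s)) (i j : Fin 4) :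
    g.val (c t) (covDerivAlong g c (fun s ↦ X s i) t) (X t j)
      + g.val (c t) (X t i) (covDerivAlong g c (fun s ↦ X s j) t) = 0 := by
  have h1 := hasDerivWithinAt_val g (hX i) (hX j) ht
  have h2 : HasDerivWithinAt (fun s ↦ g.val (c s) (X s i) (X s j)) 0 (Icc 0 1) t :=
    (hasDerivWithinAt_const t _ (minkowski i j)).congr (fun s hs ↦ hF s hs i j) (hF t ht i j)
  exact (uniqueDiffOn_Icc_zero_one t ht).eq_deriv _ h1 h2

/-- The matrix of the frame `F` in the frame field `E`: if both are pseudo-orthonormal then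
`F j = ∑ i, L i j • E i`. -/
def transition (g : LorentzMetric M) (E : ∀ x : M, Fin 4 → TangentSpace (𝓡 4) x) (F : OM g) :
    Matrix (Fin 4) (Fin 4) ℝ :=
  Matrix.of fun i j ↦ frameComp g (E F.base) (F.vec j) i

/-- The matrix `A` with `∇_Y E_l = ∑ i, A i l • E_i`, where `Y` is the vector at `x` with components
`y` in the frame `E`. -/
def rotationMatrix (g : LorentzMetric M) (E : ∀ x : M, Fin 4 → TangentSpace (𝓡 4) x) (x : M)
    (y : R4) : Matrix (Fin 4) (Fin 4) ℝ :=
  Matrix.of fun i l ↦ ∑ k, rotationCoeff g E x i k l * y k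

theorem transition_spec {g : LorentzMetric M} {E : ∀ x : M, Fin 4 → TangentSpace (𝓡 4) x}
    {F : OM g} (hE : IsFrameAt g F.base (E F.base)) (j : Fin 4) :
    F.vec j = ∑ i, transition g E F i j • E F.base i :=
  hE.eq_sum _

theorem transition_lorentz {g : LorentzMetric M} {E : ∀ x : M, Fin 4 → TangentSpace (𝓡 4) x}
    {F : OM g} (hE : IsFrameAt g F.base (E F.base)) :
    (transition g E F)ᵀ * minkowski * transition g E F = minkowski := by
  ext i j
  rw [← F.isFrame i j, val_eq_sum_frameComp hE, Matrix.mul_assoc, Matrix.mul_apply]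
  refine Finset.sum_congr rfl fun k _ ↦ ?_
  rw [minkowski, Matrix.diagonal_mul, Matrix.transpose_apply]
  simp only [transition, Matrix.of_apply, frameComp]
  rw [← mul_assoc (sgn k) (sgn k), sgn_mul_self, one_mul]

theorem transition_self {g : LorentzMetric M} {E : ∀ x : M, Fin 4 → TangentSpace (𝓡 4) x}
    {F : OM g} (h : E F.base = F.vec) : transition g E F = 1 := by
  ext i j
  simp only [transition, Matrix.of_apply, frameComp]
  rw [h, F.isFrame i j, minkowski_apply, Matrix.one_apply]
  split_ifs
  · exact sgn_mul_self i
  · exact mul_zero _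

variable {g : LorentzMetric M} {κ : ℝ → OM g} {t : ℝ}

theorem IsC1Curve.diffAlong (hκ : IsC1Curve κ) (ht : t ∈ Icc (0 : ℝ) 1) (j : Fin 4) :
    DiffAlong (fun s ↦ (κ s).base) (fun s ↦ (κ s).vec j) t :=
  (hκ j).mdifferentiableOn (by simp) t ht

theorem connectionMatrix_mem (hκ : IsC1Curve κ) (ht : t ∈ Icc (0 : ℝ) 1) :
    connectionMatrix κ t ∈ lorentzAlgebra := by
  rw [mem_skewAdjointMatricesSubmodule, Matrix.IsSkewAdjoint, Matrix.IsAdjointPair]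
  ext i j
  have h := skew_of_isFrameAt g (X := fun s ↦ (κ s).vec) ht (hκ.diffAlong ht)
    (fun s _ ↦ (κ s).isFrame) i j
  rw [g.symm _ _ ((κ t).vec j)] at h
  rw [minkowski, Matrix.mul_diagonal, Matrix.diagonal_mul, Matrix.transpose_apply]
  simp only [connectionMatrix, Matrix.neg_apply, Matrix.of_apply, frameComp]
  have hi := sgn_mul_self i
  have hj := sgn_mul_self j
  linear_combination h
    + g.val _ ((κ t).vec j) (covDerivAlong g (fun s ↦ (κ s).base) (fun s ↦ (κ s).vec i) t) * hj
    + g.val _ ((κ t).vec i) (covDerivAlong g (fun s ↦ (κ s).base) (fun s ↦ (κ s).vec j) t) * hi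

theorem coe_connectionForm (hκ : IsC1Curve κ) (ht : t ∈ Icc (0 : ℝ) 1) :
    (connectionForm κ t : Matrix (Fin 4) (Fin 4) ℝ) = connectionMatrix κ t :=
  congrArg Subtype.val (toAlgebra_coe ⟨connectionMatrix κ t, connectionMatrix_mem hκ ht⟩)

variable {U : Set M} {E : ∀ x : M, Fin 4 → TangentSpace (𝓡 4) x}

theorem IsFrameField.mdifferentiableAt (hE : IsFrameField g U E) {x : M} (hx : x ∈ U)
    (i : Fin 4) :
    MDifferentiableAt (𝓡 4) (𝓡 4).tangent (fun x ↦ (⟨x, E x i⟩ : TangentBundle (𝓡 4) M)) x :=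
  ((hE.smooth i).contMDiffAt (hE.isOpen.mem_nhds hx)).mdifferentiableAt (by simp)

theorem velocity_eq_sum (hE : IsFrameAt g (κ t).base (E (κ t).base)) :
    velocity (fun s ↦ (κ s).base) t = ∑ k,
      ((transition g E (κ t)).mulVec (WithLp.ofLp (canonicalForm κ t))) k • E (κ t).base k := by
  have h := (κ t).isFrame.eq_sum (velocity (fun s ↦ (κ s).base) t)
  refine h.trans ?_
  simp only [Matrix.mulVec, dotProduct, Finset.sum_smul]
  rw [Finset.sum_comm]
  refine Finset.sum_congr rfl fun m _ ↦ ?_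
  rw [transition_spec hE m, Finset.smul_sum]
  refine Finset.sum_congr rfl fun k _ ↦ ?_
  rw [smul_smul, mul_comm]
  rfl

theorem frameComp_covDeriv (y : R4) (x : M) (i l : Fin 4) :
    frameComp g (E x) (covDeriv g (fun z ↦ E z l) x (∑ k, y k • E x k)) i
      = rotationMatrix g E x y i l := by
  have h : covDeriv g (fun z ↦ E z l) x (∑ k, y k • E x k)
      = ∑ k, y k • covDeriv g (fun z ↦ E z l) x (E x k) := by
    have := map_sum (covDerivLin g (fun z ↦ E z l) x) (fun k ↦ y k • E x k) Finset.univ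
    simp only [map_smul] at this
    exact this
  rw [h]
  simp only [rotationMatrix, rotationCoeff, Matrix.of_apply, frameComp, map_sum, map_smul,
    smul_eq_mul, Finset.mul_sum]
  refine Finset.sum_congr rfl fun k _ ↦ ?_
  ring

/-- The evolution `L' = L ω - Γ(L θ) L` of the transition matrix along a curve. -/
theorem hasDerivWithinAt_transition (hκ : IsC1Curve κ) (hE : IsFrameField g U E)
    (hU : ∀ s ∈ Icc (0 : ℝ) 1, (κ s).base ∈ U) (ht : t ∈ Icc (0 : ℝ) 1) (i j : Fin 4) :
    HasDerivWithinAt (fun s ↦ transition g E (κ s) i j)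
      ((transition g E (κ t) * connectionMatrix κ t
        - rotationMatrix g E (κ t).base (WithLp.toLp 2
            ((transition g E (κ t)).mulVec (WithLp.ofLp (canonicalForm κ t))))
          * transition g E (κ t)) i j) (Icc 0 1) t := by
  have hEt := hE.isFrame _ (hU t ht)
  have hc := (hκ.diffAlong ht 0).curve
  have hEd : ∀ l, DiffAlong (fun s ↦ (κ s).base) (fun s ↦ E (κ s).base l) t := fun l ↦
    MDifferentiableAt.comp_mdifferentiableWithinAt
      (g := fun x ↦ (⟨x, E x l⟩ : TangentBundle (𝓡 4) M)) t (hE.mdifferentiableAt (hU t ht) l) hc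
  have hcov : ∀ l, sgn i * g.val (κ t).base (E (κ t).base i)
      (covDerivAlong g (fun s ↦ (κ s).base) (fun s ↦ E (κ s).base l) t)
      = rotationMatrix g E (κ t).base (WithLp.toLp 2
            ((transition g E (κ t)).mulVec (WithLp.ofLp (canonicalForm κ t)))) i l := fun l ↦ by
    rw [covDerivAlong_comp g (hE.mdifferentiableAt (hU t ht) l) hc ht, velocity_eq_sum hEt,
      ← frameComp_covDeriv]
    rfl
  have hskew : ∀ l, g.val (κ t).base
      (covDerivAlong g (fun s ↦ (κ s).base) (fun s ↦ E (κ s).base i) t) (E (κ t).base l)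
      = -g.val (κ t).base (E (κ t).base i)
          (covDerivAlong g (fun s ↦ (κ s).base) (fun s ↦ E (κ s).base l) t) := fun l ↦
    eq_neg_of_add_eq_zero_left (skew_of_isFrameAt g (X := fun s ↦ E (κ s).base) ht hEd
      (fun s hs ↦ hE.isFrame _ (hU s hs)) i l)
  have h1 := (hasDerivWithinAt_val g (hEd i) (hκ.diffAlong ht j) ht).const_mul (sgn i)
  refine h1.congr_deriv ?_
  -- Moving `∇` from `E i` to the other factor gives the term `- Γ(L θ) L`.
  have hA : sgn i * g.val (κ t).base
      (covDerivAlong g (fun s ↦ (κ s).base) (fun s ↦ E (κ s).base i) t) ((κ t).vec j)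
      = -(rotationMatrix g E (κ t).base (WithLp.toLp 2
            ((transition g E (κ t)).mulVec (WithLp.ofLp (canonicalForm κ t))))
          * transition g E (κ t)) i j := by
    rw [transition_spec hEt j, Matrix.mul_apply, ← Finset.sum_neg_distrib]
    simp only [map_sum, map_smul, smul_eq_mul, Finset.mul_sum, hskew, ← hcov]
    refine Finset.sum_congr rfl fun l _ ↦ ?_
    ring
  -- Expanding `∇ κ_j` in the frame `κ` gives the term `L ω`.
  have hB : sgn i * g.val (κ t).base (E (κ t).base i)
      (covDerivAlong g (fun s ↦ (κ s).base) (fun s ↦ (κ s).vec j) t)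
      = (transition g E (κ t) * connectionMatrix κ t) i j := by
    rw [(κ t).isFrame.eq_sum (covDerivAlong g (fun s ↦ (κ s).base) (fun s ↦ (κ s).vec j) t),
      Matrix.mul_apply]
    simp only [map_sum, map_smul, smul_eq_mul, Finset.mul_sum]
    refine Finset.sum_congr rfl fun m _ ↦ ?_
    simp only [transition, connectionMatrix, Matrix.of_apply, frameComp]
    ring
  rw [mul_add, hA, hB, Matrix.sub_apply]
  ring

theorem contDiffOn_transition (hκ : IsC1Curve κ) (hE : IsFrameField g U E)
    (hU : ∀ s ∈ Icc (0 : ℝ) 1, (κ s).base ∈ U) (i j : Fin 4) :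
    ContDiffOn ℝ 1 (fun s ↦ transition g E (κ s) i j) (Icc 0 1) := by
  have hc : ContMDiffOn 𝓘(ℝ, ℝ) (𝓡 4) 1 (fun s ↦ (κ s).base) (Icc 0 1) := fun s hs ↦
    ((contMDiffWithinAt_totalSpace ..).1 (hκ 0 s hs)).1
  have hEc : ContMDiffOn 𝓘(ℝ, ℝ) (𝓡 4).tangent 1
      (fun s ↦ (⟨(κ s).base, E (κ s).base i⟩ : TangentBundle (𝓡 4) M)) (Icc 0 1) :=
    ((hE.smooth i).of_le (by simp)).comp hc hU
  intro s hs
  have hg := ContMDiffAt.comp_contMDiffWithinAt s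
    ((g.contMDiff.of_le (m := 1) (by simp)).contMDiffAt) (hc s hs)
  have h : ContMDiffWithinAt 𝓘(ℝ, ℝ) ((𝓡 4).prod 𝓘(ℝ, ℝ)) 1
      (fun m ↦ TotalSpace.mk' ℝ (E := Bundle.Trivial M ℝ) (κ m).base
        (g.val (κ m).base (E (κ m).base i) ((κ m).vec j))) (Icc 0 1) s := by
    apply ContMDiffWithinAt.clm_bundle_apply₂ (F₁ := R4) (F₂ := R4)
    · exact hg
    · exact hEc s hs
    · exact hκ j s hs
  have h2 := ((contMDiffWithinAt_totalSpace ..).1 h).2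
  exact contDiffWithinAt_const.mul (contMDiffWithinAt_iff_contDiffWithinAt.1 h2)

end

/-! ### The comparison principle -/

/-- If `f` starts in the unit ball and `∫ |f'| / |f|² < 1 / 2`, then `1 / |f|` decreases by less
than `1 / 2`, so that `|f| < 2` at the end. A barrier argument takes the place of the derivative of
`1 / |f|`, which need not exist. -/
theorem norm_lt_two_of_lintegral_lt {W : Type*} [NormedAddCommGroup W] [NormedSpace ℝ W]
    {f f' : ℝ → W} (hf : ∀ t ∈ Icc (0 : ℝ) 1, HasDerivWithinAt f (f' t) (Icc 0 1) t)
    (hf' : ContinuousOn f' (Icc 0 1)) (hpos : ∀ t ∈ Icc (0 : ℝ) 1, 1 ≤ ‖f t‖) (h0 : ‖f 0‖ ≤ 1)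
    (hint : ∫⁻ t in Icc (0 : ℝ) 1, ENNReal.ofReal (‖f' t‖ / ‖f t‖ ^ 2) < ENNReal.ofReal (1 / 2)) :
    ‖f 1‖ < 2 := by
  have hfc : ContinuousOn f (Icc 0 1) := fun t ht ↦ (hf t ht).continuousWithinAt
  have hho : ContinuousOn (fun t ↦ ‖f' t‖ / ‖f t‖ ^ 2) (Icc 0 1) :=
    hf'.norm.div (hfc.norm.pow 2) fun t ht ↦ by
      have := hpos t ht
      positivity
  -- `h` is `|f'| / |f|²` on `[0, 1]`, extended continuously to the line.
  let h : ℝ → ℝ := IccExtend zero_le_one ((Icc (0 : ℝ) 1).domRestrict fun t ↦ ‖f' t‖ / ‖f t‖ ^ 2)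
  have hh : ∀ t ∈ Icc (0 : ℝ) 1, h t = ‖f' t‖ / ‖f t‖ ^ 2 := fun t ht ↦
    IccExtend_of_mem zero_le_one _ ht
  have hcont : Continuous h := hho.domRestrict.Icc_extend'
  have hnn : ∀ t, 0 ≤ h t := fun t ↦ by
    change 0 ≤ ‖f' (projIcc 0 1 zero_le_one t)‖ / ‖f (projIcc 0 1 zero_le_one t)‖ ^ 2
    positivity
  let H : ℝ → ℝ := fun t ↦ ∫ s in (0 : ℝ)..t, h s
  have hH : ∀ t, HasDerivAt H (h t) t := fun t ↦ (hcont.integral_hasStrictDerivAt 0 t).hasDerivAt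
  have hmono : Monotone H := monotone_of_hasDerivAt_nonneg hH hnn
  have hH0 : H 0 = 0 := intervalIntegral.integral_same
  have hH1 : H 1 < 1 / 2 := by
    have e1 : H 1 = ∫ s in Icc (0 : ℝ) 1, h s := by
      rw [integral_Icc_eq_integral_Ioc]
      exact intervalIntegral.integral_of_le zero_le_one
    have e2 : ENNReal.ofReal (∫ s in Icc (0 : ℝ) 1, h s)
        = ∫⁻ s in Icc (0 : ℝ) 1, ENNReal.ofReal (h s) :=
      ofReal_integral_eq_lintegral_ofReal hcont.integrableOn_Icc (ae_of_all _ hnn)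
    have e3 : ∫⁻ s in Icc (0 : ℝ) 1, ENNReal.ofReal (h s)
        = ∫⁻ t in Icc (0 : ℝ) 1, ENNReal.ofReal (‖f' t‖ / ‖f t‖ ^ 2) :=
      setLIntegral_congr_fun measurableSet_Icc fun t ht ↦ by simp only [hh t ht]
    rw [← e3, ← e2, ← e1] at hint
    exact (ENNReal.ofReal_lt_ofReal_iff (by norm_num)).1 hint
  -- The barrier is the solution `1 / (1 - H - ε t)` of `B' = (h + ε) B²`; the `ε` makes the
  -- inequality of the derivatives strict where `|f|` meets the barrier.
  let ε : ℝ := (1 / 2 - H 1) / 2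
  have hε : 0 < ε := by
    simp only [ε]
    linarith
  have hden : ∀ t ∈ Icc (0 : ℝ) 1, 1 / 2 < 1 - H t - ε * t := fun t ht ↦ by
    have h1 := hmono ht.2
    have h2 : ε * t ≤ ε * 1 := mul_le_mul_of_nonneg_left ht.2 hε.le
    have h3 : ε = (1 / 2 - H 1) / 2 := rfl
    linarith
  let B : ℝ → ℝ := fun t ↦ (1 - H t - ε * t)⁻¹
  have hB : ∀ t ∈ Icc (0 : ℝ) 1, HasDerivAt B ((h t + ε) * B t ^ 2) t := fun t ht ↦ by
    have h1 : HasDerivAt (fun t ↦ 1 - H t - ε * t) (-h t - ε) t :=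
      (((hH t).const_sub 1).sub ((hasDerivAt_id t).const_mul ε)).congr_deriv (by simp)
    have hne : 1 - H t - ε * t ≠ 0 := by linarith [hden t ht]
    refine (h1.fun_inv hne).congr_deriv ?_
    simp only [B]
    field_simp
    ring
  have key := image_norm_le_of_norm_deriv_right_lt_deriv_boundary' (a := 0) (b := 1) hfc
    (fun t ht ↦ (hf t (Ico_subset_Icc_self ht)).mono_of_mem_nhdsWithin
      (Icc_mem_nhdsGE_of_mem ht)) (B := B) (B' := fun t ↦ (h t + ε) * B t ^ 2)
    (by simpa [B, hH0] using h0)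
    (fun t ht ↦ (hB t ht).continuousAt.continuousWithinAt)
    (fun t ht ↦ (hB t (Ico_subset_Icc_self ht)).hasDerivWithinAt)
    (fun t ht heq ↦ by
      have ht' := Ico_subset_Icc_self ht
      have hp : 0 < ‖f t‖ ^ 2 := by
        have := hpos t ht'
        positivity
      have e : ‖f' t‖ = h t * ‖f t‖ ^ 2 := by
        rw [hh t ht']
        exact (div_mul_cancel₀ _ hp.ne').symm
      rw [e, ← heq]
      nlinarith)
  have h1 := key (right_mem_Icc.2 zero_le_one)
  have h2 := hden 1 (right_mem_Icc.2 zero_le_one)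
  refine h1.trans_lt ?_
  simp only [B]
  rw [inv_lt_comm₀ (by linarith) (by norm_num)]
  linarith

/-! ### Lorentz matrices and mapping norms -/

theorem mapNorm_mul_le (A B : Matrix (Fin 4) (Fin 4) ℝ) :
    mapNorm (A * B) ≤ mapNorm A * mapNorm B := by
  simp only [mapNorm, map_mul]
  exact norm_mul_le _ _

theorem mapNorm_nonneg (A : Matrix (Fin 4) (Fin 4) ℝ) : 0 ≤ mapNorm A := norm_nonneg _

theorem mapNorm_sub_le (A B : Matrix (Fin 4) (Fin 4) ℝ) :
    mapNorm (A - B) ≤ mapNorm A + mapNorm B := by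
  simp only [mapNorm, map_sub]
  exact norm_sub_le _ _

theorem mapNorm_one : mapNorm 1 = 1 := by
  simp only [mapNorm, map_one]
  exact norm_one

theorem norm_mulVec_le (A : Matrix (Fin 4) (Fin 4) ℝ) (x : R4) :
    ‖(WithLp.toLp 2 (A.mulVec (WithLp.ofLp x)) : R4)‖ ≤ mapNorm A * ‖x‖ :=
  (Matrix.toEuclideanCLM (n := Fin 4) (𝕜 := ℝ) A).le_opNorm x

theorem one_le_sq_of_lorentz {L : Matrix (Fin 4) (Fin 4) ℝ}
    (hL : Lᵀ * minkowski * L = minkowski) : 1 ≤ L 0 0 ^ 2 := by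
  have h := congrFun (congrFun hL 0) 0
  rw [minkowski, Matrix.mul_assoc, Matrix.mul_apply] at h
  simp only [Matrix.diagonal_mul, Matrix.transpose_apply, Matrix.diagonal_apply_eq,
    Fin.sum_univ_four, sgn] at h
  simp at h
  nlinarith [sq_nonneg (L 1 0), sq_nonneg (L 2 0), sq_nonneg (L 3 0)]

theorem abs_entry_le_mapNorm (A : Matrix (Fin 4) (Fin 4) ℝ) (i j : Fin 4) :
    |A i j| ≤ mapNorm A := by
  have h := norm_mulVec_le A (EuclideanSpace.single j 1)
  have h2 := PiLp.norm_apply_le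
    (WithLp.toLp 2 (A.mulVec (WithLp.ofLp (EuclideanSpace.single j (1 : ℝ)))) : R4) i
  simp at h h2
  exact h2.trans h

theorem one_le_mapNorm_of_lorentz {L : Matrix (Fin 4) (Fin 4) ℝ}
    (hL : Lᵀ * minkowski * L = minkowski) : 1 ≤ mapNorm L :=
  ((one_le_sq_iff_one_le_abs _).1 (one_le_sq_of_lorentz hL)).trans (abs_entry_le_mapNorm L 0 0)

theorem det_sq_of_lorentz {L : Matrix (Fin 4) (Fin 4) ℝ}
    (hL : Lᵀ * minkowski * L = minkowski) : L.det ^ 2 = 1 := by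
  have h := congrArg Matrix.det hL
  have hm : minkowski.det ≠ 0 := fun h0 ↦ by
    have := congrArg Matrix.det minkowski_mul_self
    rw [Matrix.det_mul, h0, Matrix.det_one] at this
    norm_num at this
  rw [Matrix.det_mul, Matrix.det_mul, Matrix.det_transpose] at h
  have h2 : (L.det ^ 2 - 1) * minkowski.det = 0 := by linear_combination h
  linarith [(mul_eq_zero.1 h2).resolve_right hm]

theorem pos_of_continuousOn_of_ne_zero {f : ℝ → ℝ} (hf : ContinuousOn f (Icc 0 1))
    (hne : ∀ t ∈ Icc (0 : ℝ) 1, f t ≠ 0) (h0 : 0 < f 0) : 0 < f 1 := by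
  by_contra! h
  obtain ⟨t, ht, h2⟩ := intermediate_value_Icc' zero_le_one hf ⟨h, h0.le⟩
  exact hne t ht h2

/-- A continuous path of Lorentz matrices from the identity stays in the identity component. -/
theorem mem_lorentzGroup_of_path {L : ℝ → Matrix (Fin 4) (Fin 4) ℝ}
    (hc : ContinuousOn L (Icc 0 1))
    (hL : ∀ t ∈ Icc (0 : ℝ) 1, (L t)ᵀ * minkowski * L t = minkowski) (h0 : L 0 = 1) :
    L 1 ∈ lorentzGroup := by
  have h1 : (1 : ℝ) ∈ Icc (0 : ℝ) 1 := right_mem_Icc.2 zero_le_one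
  refine ⟨hL 1 h1, ?_, ?_⟩
  · have hp : 0 < (L 1).det := pos_of_continuousOn_of_ne_zero (f := fun t ↦ (L t).det)
      (Continuous.comp_continuousOn (Continuous.matrix_det continuous_id) hc)
      (fun t ht h ↦ by
        have := det_sq_of_lorentz (hL t ht)
        rw [h] at this
        norm_num at this) (by simp [h0])
    nlinarith [det_sq_of_lorentz (hL 1 h1)]
  · refine pos_of_continuousOn_of_ne_zero (f := fun t ↦ L t 0 0) ?_ (fun t ht h ↦ ?_) (by simp [h0])
    · exact (continuous_id.matrix_elem 0 0).comp_continuousOn hc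
    · have := one_le_sq_of_lorentz (hL t ht)
      rw [h] at this
      norm_num at this

theorem toEuclideanCLM_eq_sum (A : Matrix (Fin 4) (Fin 4) ℝ) :
    Matrix.toEuclideanCLM (n := Fin 4) (𝕜 := ℝ) A
      = ∑ i, ∑ j, A i j • Matrix.toEuclideanCLM (n := Fin 4) (𝕜 := ℝ) (Matrix.single i j 1) := by
  conv_lhs => rw [Matrix.matrix_eq_sum_single A]
  simp only [map_sum]
  refine Finset.sum_congr rfl fun i _ ↦ Finset.sum_congr rfl fun j _ ↦ ?_
  rw [← map_smul, Matrix.smul_single, smul_eq_mul, mul_one]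

theorem hasDerivWithinAt_sum_smul {W : Type*} [NormedAddCommGroup W] [NormedSpace ℝ W]
    (T : Fin 4 → Fin 4 → W) {L : ℝ → Matrix (Fin 4) (Fin 4) ℝ}
    {L' : Matrix (Fin 4) (Fin 4) ℝ} {s : Set ℝ} {t : ℝ}
    (h : ∀ i j, HasDerivWithinAt (fun r ↦ L r i j) (L' i j) s t) :
    HasDerivWithinAt (fun r ↦ ∑ i, ∑ j, L r i j • T i j) (∑ i, ∑ j, L' i j • T i j) s t :=
  HasDerivWithinAt.fun_sum fun i _ ↦ HasDerivWithinAt.fun_sum fun j _ ↦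
    (h i j).smul_const (T i j)

theorem hasDerivWithinAt_toEuclideanCLM {L : ℝ → Matrix (Fin 4) (Fin 4) ℝ}
    {L' : Matrix (Fin 4) (Fin 4) ℝ} {s : Set ℝ} {t : ℝ}
    (h : ∀ i j, HasDerivWithinAt (fun r ↦ L r i j) (L' i j) s t) :
    HasDerivWithinAt (fun r ↦ Matrix.toEuclideanCLM (n := Fin 4) (𝕜 := ℝ) (L r))
      (Matrix.toEuclideanCLM (n := Fin 4) (𝕜 := ℝ) L') s t := by
  rw [toEuclideanCLM_eq_sum L', funext fun r ↦ toEuclideanCLM_eq_sum (L r)]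
  exact hasDerivWithinAt_sum_smul _ h

theorem continuousOn_toEuclideanCLM {L : ℝ → Matrix (Fin 4) (Fin 4) ℝ} {s : Set ℝ}
    (h : ∀ i j, ContinuousOn (fun r ↦ L r i j) s) :
    ContinuousOn (fun r ↦ Matrix.toEuclideanCLM (n := Fin 4) (𝕜 := ℝ) (L r)) s := by
  rw [funext fun r ↦ toEuclideanCLM_eq_sum (L r)]
  exact continuousOn_finsetSum _ fun i _ ↦ continuousOn_finsetSum _ fun j _ ↦
    (h i j).smul continuousOn_const

section

variable {M : Type*} [TopologicalSpace M] [ChartedSpace R4 M] [IsManifold (𝓡 4) ∞ M]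

theorem mapNorm_rotationMatrix_le {g : LorentzMetric M}
    {E : ∀ x : M, Fin 4 → TangentSpace (𝓡 4) x} {x : M} {K : ℝ} (hK : 0 ≤ K)
    (h : rotationNorm g E x ≤ ENNReal.ofReal K) (y : R4) :
    mapNorm (rotationMatrix g E x y) ≤ K * ‖y‖ := by
  -- On unit vectors this is the definition of the norm of the array of rotation coefficients.
  have h1 : ∀ X Y Z : R4, ‖X‖ = 1 → ‖Y‖ = 1 → ‖Z‖ = 1 →
      |∑ i, ∑ k, ∑ l, rotationCoeff g E x i k l * X i * Y k * Z l| ≤ K := by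
    intro X Y Z hX hY hZ
    refine (ENNReal.ofReal_le_ofReal_iff hK).1 (le_trans ?_ h)
    exact le_iSup_of_le X <| le_iSup_of_le Y <| le_iSup_of_le Z <|
      le_iSup_of_le ⟨hX, hY, hZ⟩ le_rfl
  have h2 : ∀ X Y Z : R4,
      |∑ i, ∑ k, ∑ l, rotationCoeff g E x i k l * X i * Y k * Z l| ≤ K * ‖Y‖ * ‖Z‖ * ‖X‖ := by
    intro X Y Z
    by_cases hX : X = 0
    · simp [hX]
    by_cases hY : Y = 0
    · simp [hY]
    by_cases hZ : Z = 0
    · simp [hZ]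
    have h3 := h1 (‖X‖⁻¹ • X) (‖Y‖⁻¹ • Y) (‖Z‖⁻¹ • Z) (norm_smul_inv_norm hX)
      (norm_smul_inv_norm hY) (norm_smul_inv_norm hZ)
    have h4 : ∑ i, ∑ k, ∑ l, rotationCoeff g E x i k l * X i * Y k * Z l
        = (‖X‖ * ‖Y‖ * ‖Z‖) * ∑ i, ∑ k, ∑ l, rotationCoeff g E x i k l * (‖X‖⁻¹ • X) i
          * (‖Y‖⁻¹ • Y) k * (‖Z‖⁻¹ • Z) l := by
      have hX' := norm_ne_zero_iff.2 hX
      have hY' := norm_ne_zero_iff.2 hY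
      have hZ' := norm_ne_zero_iff.2 hZ
      simp only [Finset.mul_sum, PiLp.smul_apply, smul_eq_mul]
      refine Finset.sum_congr rfl fun i _ ↦ Finset.sum_congr rfl fun k _ ↦
        Finset.sum_congr rfl fun l _ ↦ ?_
      field_simp
    rw [h4, abs_mul, abs_of_nonneg (by positivity)]
    calc _ ≤ (‖X‖ * ‖Y‖ * ‖Z‖) * K := mul_le_mul_of_nonneg_left h3 (by positivity)
      _ = _ := by ring
  refine ContinuousLinearMap.opNorm_le_bound _ (by positivity) fun Z ↦ ?_
  -- Test the vector `X = Γ(y) Z` against itself.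
  let X : R4 := Matrix.toEuclideanCLM (n := Fin 4) (𝕜 := ℝ) (rotationMatrix g E x y) Z
  have hX : ‖X‖ * ‖X‖ = ∑ i, ∑ k, ∑ l, rotationCoeff g E x i k l * X i * y k * Z l := by
    have hXi : ∀ i, X i = ∑ k, ∑ l, rotationCoeff g E x i k l * y k * Z l := fun i ↦ by
      rw [Finset.sum_comm]
      simp only [← Finset.sum_mul]
      rfl
    rw [← sq, EuclideanSpace.norm_sq_eq]
    refine Finset.sum_congr rfl fun i _ ↦ ?_
    rw [Real.norm_eq_abs, sq_abs, sq]
    nth_rewrite 2 [hXi i]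
    simp only [Finset.mul_sum]
    refine Finset.sum_congr rfl fun k _ ↦ Finset.sum_congr rfl fun l _ ↦ ?_
    ring
  have h5 := (le_abs_self _).trans (h2 X y Z)
  rw [← hX] at h5
  change ‖X‖ ≤ _
  by_cases hX0 : ‖X‖ = 0
  · rw [hX0]
    positivity
  · exact le_of_mul_le_mul_right h5 (lt_of_le_of_ne (norm_nonneg _) (Ne.symm hX0))

end

/-! ### The norm of the transition matrix along a curve -/

section

variable {M : Type*} [TopologicalSpace M] [ChartedSpace R4 M] [IsManifold (𝓡 4) ∞ M]
  {g : LorentzMetric M} {κ : ℝ → OM g} {U : Set M} {E : ∀ x : M, Fin 4 → TangentSpace (𝓡 4) x}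

/-- The derivative of the transition matrix along a curve, `L ω - Γ(L θ) L`. -/
def transitionDeriv (g : LorentzMetric M) (E : ∀ x : M, Fin 4 → TangentSpace (𝓡 4) x)
    (κ : ℝ → OM g) (t : ℝ) : Matrix (Fin 4) (Fin 4) ℝ :=
  transition g E (κ t) * connectionMatrix κ t
    - rotationMatrix g E (κ t).base (WithLp.toLp 2
        ((transition g E (κ t)).mulVec (WithLp.ofLp (canonicalForm κ t)))) * transition g E (κ t)

/-- Since `|L| ≥ 1` and `K ≥ 1`, the derivative of `L` is bounded by `K |L|² (|ω| + |θ|)`. -/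
theorem mapNorm_transitionDeriv_le {b : Module.Basis (Fin 6) ℝ lorentzAlgebra}
    (hb : ∀ a : lorentzAlgebra, mapNorm (a : Matrix (Fin 4) (Fin 4) ℝ) ≤ algNorm b a)
    (hκ : IsC1Curve κ) {t : ℝ} (ht : t ∈ Icc (0 : ℝ) 1)
    (hE : IsFrameAt g (κ t).base (E (κ t).base)) {K : ℝ} (hK : 1 ≤ K)
    (hrot : rotationNorm g E (κ t).base ≤ ENNReal.ofReal K) :
    mapNorm (transitionDeriv g E κ t)
      ≤ √2 * K * schmidtSpeed b κ t * mapNorm (transition g E (κ t)) ^ 2 := by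
  have ha := hb (connectionForm κ t)
  rw [coe_connectionForm hκ ht] at ha
  have hu := one_le_mapNorm_of_lorentz (transition_lorentz hE)
  set L := transition g E (κ t)
  set u := mapNorm L
  set θ := canonicalForm κ t
  set α := algNorm b (connectionForm κ t)
  have hα : 0 ≤ α := Real.sqrt_nonneg _
  have h1 : mapNorm (L * connectionMatrix κ t) ≤ u * α :=
    (mapNorm_mul_le _ _).trans (mul_le_mul_of_nonneg_left ha (mapNorm_nonneg _))
  have h2 : mapNorm (rotationMatrix g E (κ t).base (WithLp.toLp 2 (L.mulVec (WithLp.ofLp θ))) * L)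
      ≤ K * (u * ‖θ‖) * u :=
    (mapNorm_mul_le _ _).trans (mul_le_mul_of_nonneg_right
      ((mapNorm_rotationMatrix_le (by linarith) hrot _).trans
        (mul_le_mul_of_nonneg_left (norm_mulVec_le L θ) (by linarith))) (mapNorm_nonneg _))
  have h3 : ‖θ‖ + α ≤ √2 * schmidtSpeed b κ t := by
    rw [schmidtSpeed, ← Real.sqrt_mul (by norm_num)]
    refine Real.le_sqrt_of_sq_le ?_
    nlinarith [sq_nonneg (‖θ‖ - α)]
  have h4 : u * α ≤ K * u ^ 2 * α := by
    refine mul_le_mul_of_nonneg_right ?_ hα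
    nlinarith
  calc mapNorm (transitionDeriv g E κ t) ≤ u * α + K * (u * ‖θ‖) * u :=
        (mapNorm_sub_le _ _).trans (add_le_add h1 h2)
    _ ≤ K * u ^ 2 * (‖θ‖ + α) := by linarith
    _ ≤ K * u ^ 2 * (√2 * schmidtSpeed b κ t) := mul_le_mul_of_nonneg_left h3 (by positivity)
    _ = _ := by ring

theorem continuousOn_transitionDeriv (hκ : IsC1Curve κ) (hE : IsFrameField g U E)
    (hU : ∀ s ∈ Icc (0 : ℝ) 1, (κ s).base ∈ U) (i j : Fin 4) :
    ContinuousOn (fun t ↦ transitionDeriv g E κ t i j) (Icc 0 1) :=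
  ((contDiffOn_transition hκ hE hU i j).continuousOn_derivWithin uniqueDiffOn_Icc_zero_one
    le_rfl).congr fun t ht ↦ ((hasDerivWithinAt_transition hκ hE hU ht i j).derivWithin
      (uniqueDiffOn_Icc_zero_one t ht)).symm

theorem mapNorm_transition_lt_two {b : Module.Basis (Fin 6) ℝ lorentzAlgebra}
    (hb : ∀ a : lorentzAlgebra, mapNorm (a : Matrix (Fin 4) (Fin 4) ℝ) ≤ algNorm b a)
    (hκ : IsC1Curve κ) (hE : IsFrameField g U E)
    (hU : ∀ s ∈ Icc (0 : ℝ) 1, (κ s).base ∈ U) (h0 : transition g E (κ 0) = 1)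
    {K ρ : ℝ} (hK : 1 ≤ K)
    (hrot : ∀ s ∈ Icc (0 : ℝ) 1, rotationNorm g E (κ s).base ≤ ENNReal.ofReal K)
    (hlen : bLength b κ < ENNReal.ofReal ρ) (hρ : K * ρ ≤ 1 / 4) :
    mapNorm (transition g E (κ 1)) < 2 := by
  have hone : ∀ t ∈ Icc (0 : ℝ) 1, 1 ≤ mapNorm (transition g E (κ t)) := fun t ht ↦
    one_le_mapNorm_of_lorentz (transition_lorentz (hE.isFrame _ (hU t ht)))
  refine norm_lt_two_of_lintegral_lt
    (f := fun t ↦ Matrix.toEuclideanCLM (n := Fin 4) (𝕜 := ℝ) (transition g E (κ t)))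
    (f' := fun t ↦ Matrix.toEuclideanCLM (n := Fin 4) (𝕜 := ℝ) (transitionDeriv g E κ t))
    (fun t ht ↦ hasDerivWithinAt_toEuclideanCLM (hasDerivWithinAt_transition hκ hE hU ht))
    (continuousOn_toEuclideanCLM (continuousOn_transitionDeriv hκ hE hU)) hone
    (by rw [h0]; exact mapNorm_one.le) ?_
  have hpt : ∀ t ∈ Icc (0 : ℝ) 1, ENNReal.ofReal
      (mapNorm (transitionDeriv g E κ t) / mapNorm (transition g E (κ t)) ^ 2)
        ≤ ENNReal.ofReal (√2 * K) * ENNReal.ofReal (schmidtSpeed b κ t) := fun t ht ↦ by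
    rw [← ENNReal.ofReal_mul (by positivity)]
    refine ENNReal.ofReal_le_ofReal ?_
    have hu := hone t ht
    rw [div_le_iff₀ (by positivity)]
    exact mapNorm_transitionDeriv_le hb hκ ht (hE.isFrame _ (hU t ht)) hK (hrot t ht)
  calc ∫⁻ t in Icc (0 : ℝ) 1, ENNReal.ofReal
          (mapNorm (transitionDeriv g E κ t) / mapNorm (transition g E (κ t)) ^ 2)
      ≤ ∫⁻ t in Icc (0 : ℝ) 1,
          ENNReal.ofReal (√2 * K) * ENNReal.ofReal (schmidtSpeed b κ t) :=
        setLIntegral_mono' measurableSet_Icc hpt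
    _ = ENNReal.ofReal (√2 * K) * bLength b κ :=
        lintegral_const_mul' _ _ ENNReal.ofReal_ne_top
    _ ≤ ENNReal.ofReal (√2 * K) * ENNReal.ofReal ρ := mul_le_mul_right hlen.le _
    _ = ENNReal.ofReal (√2 * K * ρ) := (ENNReal.ofReal_mul (by positivity)).symm
    _ < ENNReal.ofReal (1 / 2) := by
        rw [ENNReal.ofReal_lt_ofReal_iff (by norm_num)]
        have h2 : √2 < 2 := by
          rw [Real.sqrt_lt' (by norm_num)]
          norm_num
        nlinarith [Real.sqrt_nonneg 2]

end

end SpaceTime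

end

theorem mainTheorem6 {M : Type*} [TopologicalSpace M] [T2Space M] [ChartedSpace SpaceTime.R4 M]
    [IsManifold (𝓡 4) ∞ M] (g : SpaceTime.LorentzMetric M)
    (b : Module.Basis (Fin 6) ℝ SpaceTime.lorentzAlgebra)
    (hb : ∀ a : SpaceTime.lorentzAlgebra,
      SpaceTime.mapNorm (a : Matrix (Fin 4) (Fin 4) ℝ) ≤ SpaceTime.algNorm b a)
    (Ep : SpaceTime.OM g) (ρ : ℝ) (V : Set (SpaceTime.OM g))
    (hV : V ⊆ SpaceTime.bBall b Ep ρ)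
    (hVV : ∀ F ∈ V, SpaceTime.bDistIn b V Ep F < ENNReal.ofReal ρ)
    (U : Set M) (hU : ∀ F ∈ V, F.base ∈ U)
    (E : ∀ x : M, Fin 4 → TangentSpace (𝓡 4) x) (hE : SpaceTime.IsFrameField g U E)
    (hEp : E Ep.base = Ep.vec)
    (hρ : ENNReal.ofReal ρ ≤ 1 / (4 * SpaceTime.rotationBound E V)) :
    ∀ F ∈ V, ∃ L ∈ SpaceTime.lorentzGroup,
      (∀ j, F.vec j = ∑ i, L i j • E F.base i) ∧ SpaceTime.mapNorm L < 2 := by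
  intro F hF
  have hF2 := hVV F hF
  simp only [SpaceTime.bDistIn, iInf_lt_iff] at hF2
  obtain ⟨κ, hκ, hκV, hκ0, hκ1, hlen⟩ := hF2
  have hρ0 : 0 < ENNReal.ofReal ρ := bot_le.trans_lt hlen
  have hρpos : 0 < ρ := ENNReal.ofReal_pos.1 hρ0
  -- The bound `K` is finite, as otherwise `1 / (4 K) = 0` and no curve would be short enough.
  have hKtop : SpaceTime.rotationBound E V ≠ ⊤ := fun h ↦ by
    rw [h, ENNReal.mul_top (by norm_num), ENNReal.div_top] at hρ
    exact absurd hρ (not_le.2 hρ0)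
  obtain ⟨K, hK⟩ : ∃ K : ℝ, K = (SpaceTime.rotationBound E V).toReal := ⟨_, rfl⟩
  have hKof : ENNReal.ofReal K = SpaceTime.rotationBound E V := by
    rw [hK, ENNReal.ofReal_toReal hKtop]
  have hK1 : 1 ≤ K := by
    have h : (1 : ℝ≥0∞) ≤ SpaceTime.rotationBound E V := le_max_right _ _
    rw [← hKof] at h
    exact ENNReal.one_le_ofReal.1 h
  have hKρ : K * ρ ≤ 1 / 4 := by
    have h4 : (4 : ℝ≥0∞) = ENNReal.ofReal 4 := by norm_num
    rw [← hKof, h4, ← ENNReal.ofReal_mul (by norm_num), ← ENNReal.ofReal_one,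
      ← ENNReal.ofReal_div_of_pos (by linarith), ENNReal.ofReal_le_ofReal_iff (by positivity),
      le_div_iff₀ (by linarith)] at hρ
    linarith
  have hκU : ∀ s ∈ Icc (0 : ℝ) 1, (κ s).base ∈ U := fun s hs ↦ hU _ (hκV hs)
  have h0 : SpaceTime.transition g E (κ 0) = 1 := by
    rw [hκ0]
    exact SpaceTime.transition_self hEp
  refine ⟨SpaceTime.transition g E F, ?_, SpaceTime.transition_spec (hE.isFrame _ (hU F hF)), ?_⟩
  · rw [← hκ1]
    refine SpaceTime.mem_lorentzGroup_of_path (L := fun t ↦ SpaceTime.transition g E (κ t)) ?_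
      (fun t ht ↦ SpaceTime.transition_lorentz (hE.isFrame _ (hκU t ht))) h0
    exact continuousOn_pi.2 fun i ↦ continuousOn_pi.2 fun j ↦
      (SpaceTime.contDiffOn_transition hκ hE hκU i j).continuousOn
  · rw [← hκ1]
    refine SpaceTime.mapNorm_transition_lt_two hb hκ hE hκU h0 hK1 (fun s hs ↦ ?_) hlen hKρ
    have hsup : SpaceTime.rotationNorm g E (κ s).base
        ≤ ⨆ F ∈ V, SpaceTime.rotationNorm g E F.base :=
      le_iSup₂_of_le (κ s) (hκV hs) le_rfl
    rw [hKof]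
    exact hsup.trans (le_max_left _ _)
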